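/- Let $N,D\ge 1$, $1\le r\le N$, $\sigma>0$, $\varepsilon>0$, $p\in[0,1]$, and let $\mathcal Y=\{1,\dots,K\}$ with $K\ge 2$. For $X\in\mathbb R^{N\times D}$ with rows $x_1,\dots,x_N$, the hierarchical smoothing distribution $\Psi_X$ on $\mathbb R^{N\times D}\times\{0,1\}^N$ is the law of $(W,\tau)$, where $\tau_1,\dots,\tau_N$ are independent $\mathrm{Ber}(p)$ variables and, given $\tau$, the rows $w_i$ of $W$ are independent with $w_i\sim\mathcal N(x_i,\sigma^2 I_D)$ if $\tau_i=1$ and $w_i=x_i$ if $\tau_i=0$. Let $$\mathcal B^r_{2,\varepsilon}(X)=\Bigl\{\tilde X\in\mathbb R^{N\times D} : |\{i: x_i\ne\tilde x_i\}|\le r,\ \|\mathrm{vec}(X-\tilde X)\|_2\le\varepsilon\Bigr\}.$$ Fix $X$, a measurable classifier $f:\mathbb R^{N\times D}\times\{0,1\}^N\to\mathcal Y$ and a label $y\in\mathcal Y$. Put $p_{X,y}=\Pr_{Z\sim\Psi_X}[f(Z)=y]$ and, for $\tilde X\in\mathbb R^{N\times D}$, $$\underline{p_{\tilde X,y}}=\min_h\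 \Pr_{Z\sim\Psi_{\tilde X}}[h(Z)=y]\quad\text{s.t.}\quad \Pr_{Z\sim\Psi_X}[h(Z)=y]=p_{X,y},$$ where $h$ ranges over the measurable classifiers $\mathbb R^{N\times D}\times\{0,1\}^N\to\mathcal Y$. Let $\Delta=1-p^r$, and assume that $p_{X,y}\ge\Delta$ or $p=0$. Then the minimum defining $\underline{p_{\tilde X,y}}$ is attained for every $\tilde X\in\mathcal B^r_{2,\varepsilon}(X)$, and $$\min_{\tilde X\in\mathcal B^r_{2,\varepsilon}(X)}\underline{p_{\tilde X,y}}=\Phi\!\left(\Phi^{-1}\!\left(\frac{p_{X,y}-\Delta}{1-\Delta}\right)-\frac{\varepsilon}{\sigma}\right)(1-\Delta),$$ where the minimum is attained. Here $\Phi$ is the standard normal distribution function, $\Phi(-\infty)=0$, $\Phi(\infty)=1$, $\Phi^{-1}(0)=-\infty$, $\Phi^{-1}(1)=\infty$, and for $p=0$ (that is, $\Delta=1$) the right-hand side is read as $0$. -/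

import Mathlib

open MeasureTheory ProbabilityTheory

noncomputable section

/-- Real `N × D` matrices `X = (x₁ | … | x_N)ᵀ`; `X i` is the `i`-th row. -/
abbrev DataMatrix (N D : ℕ) : Type := Fin N → Fin D → ℝ

/-- The extended space `ℝ^{N × D} × {0,1}^N` of matrices `W` with an appended indicator
column `τ`; `τ i = true` means that row `i` is selected for smoothing. -/
abbrev ExtMatrix (N D : ℕ) : Type := DataMatrix N D × (Fin N → Bool)

/-- The Frobenius norm `‖vec M‖₂`. -/
def frobeniusNorm {N D : ℕ} (M : DataMatrix N D) : ℝ :=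
  Real.sqrt (∑ i, ∑ j, M i j ^ 2)

/-- The rows in which two matrices differ. -/
def perturbedRows {N D : ℕ} (X X' : DataMatrix N D) : Finset (Fin N) :=
  {i | X i ≠ X' i}

/-- The threat model: at most `r` rows are perturbed, and the perturbation has `ℓ₂`-norm
at most `ε`. -/
def threatBall {N D : ℕ} (r : ℕ) (ε : ℝ) (X : DataMatrix N D) : Set (DataMatrix N D) :=
  {X' | (perturbedRows X X').card ≤ r ∧ frobeniusNorm (X - X') ≤ ε}

/-- The upper-level distribution: the entries of `τ` are independent `Ber(p)` variables. -/
def upperLevel (N : ℕ) (p : unitInterval) : Measure (Fin N → Bool) :=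
  Measure.pi fun _ => bernoulliMeasure true false p

/-- The isotropic Gaussian distribution `𝒩(x, σ² I)` on a row. -/
def rowGaussian {D : ℕ} (σ : ℝ) (x : Fin D → ℝ) : Measure (Fin D → ℝ) :=
  Measure.pi fun j => gaussianReal (x j) (Real.toNNReal (σ ^ 2))

/-- The conditional distribution `μ_X(· | τ)`: the rows are independent, a selected row has
Gaussian noise added, and any other row is kept (point mass). -/
def lowerLevel {N D : ℕ} (σ : ℝ) (X : DataMatrix N D) (τ : Fin N → Bool) :
    Measure (DataMatrix N D) :=
  Measure.pi fun i => if τ i then rowGaussian σ (X i) else Measure.dirac (X i)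

/-- The hierarchical smoothing distribution `Ψ_X(W, τ) = μ_X(W | τ) φ(τ)`: the law of `(W, τ)`
where `τ` is drawn from the upper level and then `W` from `μ_X(· | τ)`. -/
def hierarchical {N D : ℕ} (p : unitInterval) (σ : ℝ) (X : DataMatrix N D) :
    Measure (ExtMatrix N D) :=
  ∑ τ : Fin N → Bool, upperLevel N p {τ} • (lowerLevel σ X τ).map fun W => (W, τ)

/-- The probability that the classifier `h` outputs the label `y` under `Ψ_X`. -/
def labelProb {N D K : ℕ} (p : unitInterval) (σ : ℝ) (h : ExtMatrix N D → Fin K) (y : Fin K)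
    (X : DataMatrix N D) : ℝ :=
  (hierarchical p σ X).real {Z | h Z = y}

/-- All values `Pr_{Z ∼ Ψ_X'}[h(Z) = y]` over the (measurable) classifiers `h` that satisfy
`Pr_{Z ∼ Ψ_X}[h(Z) = y] = Pr_{Z ∼ Ψ_X}[f(Z) = y]`. -/
def feasibleValues {N D K : ℕ} (p : unitInterval) (σ : ℝ) (f : ExtMatrix N D → Fin K)
    (y : Fin K) (X X' : DataMatrix N D) : Set ℝ :=
  {v | ∃ h : ExtMatrix N D → Fin K, Measurable h ∧
    labelProb p σ h y X = labelProb p σ f y X ∧ labelProb p σ h y X' = v}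

/-- The worst-case lower bound on the probability of label `y` at `X'`. -/
def worstCaseProb {N D K : ℕ} (p : unitInterval) (σ : ℝ) (f : ExtMatrix N D → Fin K)
    (y : Fin K) (X X' : DataMatrix N D) : ℝ :=
  sInf (feasibleValues p σ f y X X')

/-- The standard normal distribution function `Φ`, with `Φ(-∞) = 0` and `Φ(∞) = 1`. -/
def normalCDF (x : EReal) : ℝ :=
  (gaussianReal 0 1).real {t : ℝ | (t : EReal) ≤ x}

/-- The inverse `Φ⁻¹` on `[0,1]`, with `Φ⁻¹(0) = -∞` and `Φ⁻¹(1) = ∞`. -/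
def normalCDFInv (u : ℝ) : EReal :=
  sInf {x : EReal | u ≤ normalCDF x}

end

/-! Let `X'` differ from `X` in `c ≥ 1` rows, let `p > 0`, put `s = p ^ c`, and let `P` be the
prescribed probability at `X`. The indicator `τ` selects all differing rows with probability `s`
under both laws. If some differing row is not selected, it is seen without noise, so the two laws
are mutually singular there: `keptEvent X \ selectedEvent X X'` has mass `1 - s` under the law at
`X` and is null under the law at `X'` (`hierarchical_keptEvent_diff`). A worst classifier takes this
mass for free. If all of them are selected, the law at `X'` has a density with respect to the law at
`X`. It is an increasing function of one linear statistic, `displacement`, with laws `𝒩(0, 1)` at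
`X` and `𝒩(‖X - X'‖ / σ, 1)` at `X'`. By Neyman–Pearson the remaining mass `P - (1 - s)` is best
spent on a half-space (`hierarchical_sublevelEvent_le`). This gives the minimum `certifiedProb P s
(‖X - X'‖ / σ)` (`isLeast_feasibleValues`), which increases in `s` and decreases in the shift. Over
the threat model it is least when `c = r` and the norm is `ε`, and such an `X'` exists. -/

/-! ### Neyman–Pearson and densities of product and Gaussian measures -/

/-- **Neyman–Pearson**, relative to a region `R` on which `ν` has density `L` with respect to
`μ`. -/
theorem neymanPearson_of_density {α : Type*} [MeasurableSpace α] {μ ν : Measure α}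
    [IsFiniteMeasure μ] {R A B : Set α} {L : α → ENNReal}
    (hL : ∀ S ⊆ R, MeasurableSet S → ν S = ∫⁻ a in S, L a ∂μ)
    (hA : MeasurableSet A) (hAR : A ⊆ R) (hB : MeasurableSet B) (hBR : B ⊆ R) {k : ENNReal}
    (hle : ∀ a ∈ A, L a ≤ k) (hge : ∀ a ∈ R, a ∉ A → k ≤ L a) (hAB : μ A ≤ μ B) :
    ν A ≤ ν B := by
  -- The common part `A ∩ B` cancels because `μ` is finite; what is left compares `L ≤ k` on `A \ B`
  -- with `k ≤ L` on `B \ A`.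
  have h1 : μ (A \ B) ≤ μ (B \ A) := by
    have e1 := measure_inter_add_sdiff (μ := μ) A hB
    have e2 := measure_inter_add_sdiff (μ := μ) B hA
    rw [← e1, ← e2, Set.inter_comm B A] at hAB
    exact (ENNReal.add_le_add_iff_left (measure_ne_top μ _)).1 hAB
  have h2 : ν (A \ B) ≤ ν (B \ A) := by
    rw [hL _ (Set.sdiff_subset.trans hAR) (hA.diff hB), hL _ (Set.sdiff_subset.trans hBR) (hB.diff hA)]
    calc ∫⁻ a in A \ B, L a ∂μ ≤ ∫⁻ _ in A \ B, k ∂μ :=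
          setLIntegral_mono' (hA.diff hB) fun a ha => hle a ha.1
      _ = k * μ (A \ B) := by simp
      _ ≤ k * μ (B \ A) := by gcongr
      _ = ∫⁻ _ in B \ A, k ∂μ := by simp
      _ ≤ ∫⁻ a in B \ A, L a ∂μ :=
          setLIntegral_mono' (hB.diff hA) fun a ha => hge a (hBR ha.1) ha.2
  rw [← measure_inter_add_sdiff (μ := ν) A hB, ← measure_inter_add_sdiff (μ := ν) B hA,
    Set.inter_comm B A]
  gcongr

/-- It suffices to test boxes. The indicator of a box times the product density is a product of
functions of independent coordinates, so its integral factorizes. -/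
theorem MeasureTheory.Measure.pi_withDensity {ι : Type*} [Fintype ι] {α : ι → Type*}
    [∀ i, MeasurableSpace (α i)] (μ : ∀ i, Measure (α i)) [∀ i, IsProbabilityMeasure (μ i)]
    {f : ∀ i, α i → ENNReal} (hf : ∀ i, Measurable (f i))
    [∀ i, SigmaFinite ((μ i).withDensity (f i))] :
    Measure.pi (fun i => (μ i).withDensity (f i)) =
      (Measure.pi μ).withDensity fun x => ∏ i, f i (x i) := by
  refine Measure.pi_eq fun s hs => ?_
  rw [withDensity_apply _ (MeasurableSet.univ_pi hs), ← lintegral_indicator (MeasurableSet.univ_pi hs)]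
  have hg : ∀ i, Measurable ((s i).indicator (f i)) := fun i => (hf i).indicator (hs i)
  have hind : iIndepFun (fun i (x : ∀ i, α i) => (s i).indicator (f i) (x i)) (Measure.pi μ) :=
    iIndepFun_pi (X := fun i => (s i).indicator (f i)) fun i => (hg i).aemeasurable
  have := lintegral_prod_eq_prod_lintegral_of_indepFun Finset.univ _ hind
    fun i => (hg i).comp (measurable_pi_apply i)
  calc _ = ∫⁻ x, ∏ i, (s i).indicator (f i) (x i) ∂Measure.pi μ := by
        congr 1 with x
        by_cases hx : x ∈ Set.univ.pi s
        · rw [Set.indicator_of_mem hx]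
          exact Finset.prod_congr rfl fun i _ => (Set.indicator_of_mem (hx i trivial) _).symm
        · rw [Set.indicator_of_notMem hx]
          simp only [Set.mem_pi, Set.mem_univ, true_implies, not_forall] at hx
          obtain ⟨i, hi⟩ := hx
          exact (Finset.prod_eq_zero (Finset.mem_univ i) (Set.indicator_of_notMem hi _)).symm
    _ = ∏ i, ∫⁻ x, (s i).indicator (f i) (x i) ∂Measure.pi μ := this
    _ = _ := by
        refine Finset.prod_congr rfl fun i _ => ?_
        rw [withDensity_apply _ (hs i), ← lintegral_indicator (hs i),
          ← (measurePreserving_eval μ i).lintegral_comp (hg i)]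

theorem ProbabilityTheory.gaussianReal_eq_withDensity (a b : ℝ) {v : NNReal} (hv : v ≠ 0) :
    gaussianReal b v = (gaussianReal a v).withDensity fun x =>
      ENNReal.ofReal (Real.exp ((x - a) * (b - a) / v - (b - a) ^ 2 / (2 * v))) := by
  have hv' : (v : ℝ) ≠ 0 := by exact_mod_cast hv
  rw [gaussianReal_of_var_ne_zero _ hv, gaussianReal_of_var_ne_zero _ hv,
    ← withDensity_mul _ (measurable_gaussianPDF _ _) (by fun_prop)]
  congr 1 with x
  simp only [gaussianPDF, gaussianPDFReal, Pi.mul_apply]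
  rw [← ENNReal.ofReal_mul (by positivity), mul_assoc _ (Real.exp _) (Real.exp _), ← Real.exp_add]
  congr 3
  field_simp
  ring

/-! ### The normal distribution function and its inverse -/

theorem normalCDF_mono : Monotone normalCDF := fun _ _ h =>
  measureReal_mono fun _ ht => le_trans ht h

theorem normalCDF_nonneg (x : EReal) : 0 ≤ normalCDF x := measureReal_nonneg

theorem normalCDF_bot : normalCDF ⊥ = 0 := by simp [normalCDF]

theorem normalCDF_top : normalCDF ⊤ = 1 := by simp [normalCDF]

theorem normalCDF_coe (x : ℝ) : normalCDF x = (gaussianReal 0 1).real (Set.Iic x) := by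
  simp [normalCDF, Set.Iic]

theorem normalCDFInv_mono : Monotone normalCDFInv := fun _ _ h =>
  sInf_le_sInf fun _ hx => le_trans h hx

/-- The Gaussian has no atoms, so its distribution function has no jumps. -/
theorem continuous_normalCDF_coe : Continuous fun x : ℝ => normalCDF x := by
  have : NullSingletonClass (gaussianReal 0 1) := nullSingletonClass_gaussianReal one_ne_zero
  have h : (fun x : ℝ => normalCDF x) = cdf (gaussianReal 0 1) := by
    ext x; rw [normalCDF_coe, cdf_eq_real]
  rw [h, continuous_iff_continuousAt]
  intro x
  rw [(monotone_cdf _).continuousAt_iff_leftLim_eq_rightLim, StieltjesFunction.rightLim_eq]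
  have h1 := (cdf (gaussianReal 0 1)).measure_singleton x
  rw [measure_cdf, measure_singleton, eq_comm, ENNReal.ofReal_eq_zero] at h1
  exact le_antisymm ((monotone_cdf _).leftLim_le le_rfl) (by linarith)

theorem normalCDF_lt_one (x : ℝ) : normalCDF x < 1 := by
  have h := measureReal_compl (μ := gaussianReal 0 1) (measurableSet_Iic (a := x))
  have hpos : 0 < (gaussianReal 0 1).real (Set.Iic x)ᶜ := by
    rw [Measure.real, ENNReal.toReal_pos_iff]
    refine ⟨pos_iff_ne_zero.2 fun h0 => ?_, measure_lt_top _ _⟩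
    -- A Gaussian-null set is Lebesgue-null, but a half-line is not.
    have := gaussianReal_absolutelyContinuous' 0 one_ne_zero h0
    simp at this
  rw [probReal_univ] at h
  rw [normalCDF_coe]
  linarith

/-- For `0 < u < 1` the value `u` is taken by continuity, which gives `≤`; right continuity at the
infimum gives `≥`. The endpoints correspond to `⊥` and `⊤`. -/
theorem normalCDF_normalCDFInv {u : ℝ} (h0 : 0 ≤ u) (h1 : u ≤ 1) :
    normalCDF (normalCDFInv u) = u := by
  rcases h0.eq_or_lt with rfl | h0
  · have : normalCDFInv 0 = ⊥ := by
      rw [normalCDFInv, ← le_bot_iff]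
      exact sInf_le normalCDF_bot.ge
    rw [this, normalCDF_bot]
  rcases h1.eq_or_lt with rfl | h1
  · have : normalCDFInv 1 = ⊤ := by
      rw [normalCDFInv, sInf_eq_top]
      intro x hx
      induction x with
      | bot => simp [normalCDF_bot] at hx; linarith
      | top => rfl
      | coe x => exact absurd hx (normalCDF_lt_one x).not_ge
    rw [this, normalCDF_top]
  have hcdf : ∀ x : ℝ, normalCDF x = cdf (gaussianReal 0 1) x := fun x => by
    rw [normalCDF_coe, cdf_eq_real]
  obtain ⟨x, hx⟩ : ∃ x : ℝ, normalCDF x = u := by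
    refine mem_range_of_exists_le_of_exists_ge continuous_normalCDF_coe ?_ ?_
    · obtain ⟨x, hx⟩ := ((tendsto_cdf_atBot (gaussianReal 0 1)).eventually_lt_const h0).exists
      exact ⟨x, by rw [hcdf]; exact hx.le⟩
    · obtain ⟨x, hx⟩ := ((tendsto_cdf_atTop (gaussianReal 0 1)).eventually_const_lt h1).exists
      exact ⟨x, by rw [hcdf]; exact hx.le⟩
  have hle : normalCDFInv u ≤ x := sInf_le hx.ge
  refine le_antisymm ((normalCDF_mono hle).trans hx.le) ?_
  induction h : normalCDFInv u with
  | top => simpa [normalCDF_top] using h1.le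
  | bot =>
    exfalso
    have hall : ∀ y : ℝ, u ≤ normalCDF y := fun y => by
      have : sInf {x : EReal | u ≤ normalCDF x} < y := by
        rw [show sInf {x : EReal | u ≤ normalCDF x} = ⊥ from h]; exact EReal.bot_lt_coe y
      obtain ⟨z, hz, hzy⟩ := sInf_lt_iff.1 this
      exact le_trans hz (normalCDF_mono hzy.le)
    obtain ⟨y, hy⟩ := ((tendsto_cdf_atBot (gaussianReal 0 1)).eventually_lt_const h0).exists
    rw [← hcdf] at hy
    exact absurd (hall y) hy.not_ge
  | coe a =>
    have hall : ∀ y : ℝ, a < y → u ≤ normalCDF y := fun y hy => by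
      have : sInf {x : EReal | u ≤ normalCDF x} < y := by
        rw [show sInf {x : EReal | u ≤ normalCDF x} = a from h]; exact_mod_cast hy
      obtain ⟨z, hz, hzy⟩ := sInf_lt_iff.1 this
      exact le_trans hz (normalCDF_mono hzy.le)
    exact ge_of_tendsto (continuous_normalCDF_coe.continuousWithinAt (s := Set.Ioi a) (x := a))
      (Filter.eventually_of_mem self_mem_nhdsWithin hall)

theorem gaussianReal_real_le (m : ℝ) (z : EReal) :
    (gaussianReal m 1).real {t : ℝ | (t : EReal) ≤ z} = normalCDF (z - m) := by
  have hm : Measurable fun t : ℝ => t + m := by fun_prop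
  have : gaussianReal m 1 = (gaussianReal 0 1).map (· + m) := by
    rw [gaussianReal_map_add_const, zero_add]
  rw [this, normalCDF, map_measureReal_apply hm
    (measurableSet_le measurable_coe_real_ereal measurable_const)]
  congr 1 with t
  simp only [Set.mem_preimage, Set.mem_ofPred_eq, EReal.coe_add]
  rw [EReal.le_sub_iff_add_le] <;> simp

/-! ### The hierarchical distribution, computed section by section in `τ` -/

instance rowGaussian.instIsProbabilityMeasure {D : ℕ} (σ : ℝ) (x : Fin D → ℝ) :
    IsProbabilityMeasure (rowGaussian σ x) := by
  unfold rowGaussian; infer_instance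

instance ite_rowGaussian_dirac.instIsProbabilityMeasure {D : ℕ} (σ : ℝ) (x : Fin D → ℝ)
    (b : Bool) :
    IsProbabilityMeasure (if b then rowGaussian σ x else Measure.dirac x) := by
  split_ifs <;> infer_instance

instance lowerLevel.instIsProbabilityMeasure {N D : ℕ} (σ : ℝ) (X : DataMatrix N D)
    (τ : Fin N → Bool) : IsProbabilityMeasure (lowerLevel σ X τ) := by
  unfold lowerLevel; infer_instance

instance upperLevel.instIsProbabilityMeasure (N : ℕ) (p : unitInterval) :
    IsProbabilityMeasure (upperLevel N p) := by
  unfold upperLevel; infer_instance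

theorem hierarchical_apply {N D : ℕ} (p : unitInterval) (σ : ℝ) (X : DataMatrix N D)
    {S : Set (ExtMatrix N D)} (hS : MeasurableSet S) :
    hierarchical p σ X S =
      ∑ τ, upperLevel N p {τ} * lowerLevel σ X τ {W | (W, τ) ∈ S} := by
  simp only [hierarchical, Measure.finsetSum_apply, Measure.smul_apply, smul_eq_mul]
  refine Finset.sum_congr rfl fun τ _ => ?_
  rw [Measure.map_apply (by fun_prop) hS]
  rfl

/-- An event that has conditional probability `a` for every indicator in `s`, and is empty for
the others. -/
theorem hierarchical_apply_of_section {N D : ℕ} (p : unitInterval) (σ : ℝ) (X : DataMatrix N D)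
    {S : Set (ExtMatrix N D)} (hS : MeasurableSet S) (s : Set (Fin N → Bool)) (a : ENNReal)
    (h1 : ∀ τ ∈ s, lowerLevel σ X τ {W | (W, τ) ∈ S} = a)
    (h0 : ∀ τ ∉ s, lowerLevel σ X τ {W | (W, τ) ∈ S} = 0) :
    hierarchical p σ X S = upperLevel N p s * a := by
  classical
  rw [hierarchical_apply p σ X hS]
  have hs : upperLevel N p s = ∑ τ, if τ ∈ s then upperLevel N p {τ} else 0 := by
    rw [← Finset.sum_filter, sum_measure_singleton]
    congr 1; ext; simp
  rw [hs, Finset.sum_mul]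
  refine Finset.sum_congr rfl fun τ _ => ?_
  split_ifs with h
  · rw [h1 τ h]
  · rw [h0 τ h]; simp

instance hierarchical.instIsProbabilityMeasure {N D : ℕ} (p : unitInterval) (σ : ℝ)
    (X : DataMatrix N D) : IsProbabilityMeasure (hierarchical p σ X) where
  measure_univ := by
    rw [hierarchical_apply_of_section p σ X MeasurableSet.univ Set.univ 1] <;> simp

theorem upperLevel_forall_mem {N : ℕ} (p : unitInterval) (C : Finset (Fin N)) :
    upperLevel N p {τ | ∀ i ∈ C, τ i = true} = ENNReal.ofReal ((p : ℝ) ^ C.card) := by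
  classical
  have : {τ : Fin N → Bool | ∀ i ∈ C, τ i = true} =
      Set.univ.pi fun i => if i ∈ C then {true} else Set.univ := by
    ext τ
    simp only [Set.mem_ofPred_eq, Set.mem_pi, Set.mem_univ, true_implies]
    refine forall_congr' fun i => ?_
    split_ifs with h <;> simp [h]
  rw [this, upperLevel, Measure.pi_pi, ENNReal.ofReal_pow p.2.1]
  have : ∀ i, bernoulliMeasure true false p (if i ∈ C then {true} else Set.univ) =
      if i ∈ C then ENNReal.ofReal p else 1 := fun i => by
    split_ifs
    · rw [bernoulliMeasure_apply p (measurableSet_singleton _)]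
      simp only [Set.mem_singleton_iff, if_true, Bool.false_eq_true, if_false]
      exact (ENNReal.ofReal_eq_coe_nnreal p.2.1).symm
    · simp
  simp only [this, Finset.prod_ite, Finset.prod_const, Finset.filter_mem_eq_inter,
    Finset.univ_inter, one_pow, mul_one]

theorem lowerLevel_ae_eq {N D : ℕ} (σ : ℝ) (X : DataMatrix N D) (τ : Fin N → Bool) :
    ∀ᵐ W ∂lowerLevel σ X τ, ∀ i, τ i = false → W i = X i := by
  rw [ae_all_iff]
  intro i
  by_cases h : τ i = false
  · have := (measurePreserving_eval
      (fun i => if τ i then rowGaussian σ (X i) else Measure.dirac (X i)) i).quasiMeasurePreserving.ae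
      (p := fun w => w = X i) (by simp [h])
    filter_upwards [this] with W hW _ using hW
  · simp [h]

/-! ### The likelihood ratio on the selected event -/

/-- The likelihood ratio between the noise around `X'` and the noise around `X`. -/
noncomputable def likelihoodRatio {N D : ℕ} (σ : ℝ) (X X' W : DataMatrix N D) : ENNReal :=
  ∏ i, ∏ j, ENNReal.ofReal (Real.exp
    ((W i j - X i j) * (X' i j - X i j) / (Real.toNNReal (σ ^ 2) : ℝ) -
      (X' i j - X i j) ^ 2 / (2 * (Real.toNNReal (σ ^ 2) : ℝ))))

theorem lowerLevel_eq_withDensity {N D : ℕ} {σ : ℝ} (hσ : 0 < σ) {X X' : DataMatrix N D}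
    {τ : Fin N → Bool} (h : ∀ i, τ i = false → X i = X' i) :
    lowerLevel σ X' τ = (lowerLevel σ X τ).withDensity (likelihoodRatio σ X X') := by
  have hv : Real.toNNReal (σ ^ 2) ≠ 0 := by
    rw [ne_eq, Real.toNNReal_eq_zero, not_le]; positivity
  set g : ∀ (i : Fin N) (j : Fin D), ℝ → ENNReal := fun i j x => ENNReal.ofReal (Real.exp
    ((x - X i j) * (X' i j - X i j) / (Real.toNNReal (σ ^ 2) : ℝ) -
      (X' i j - X i j) ^ 2 / (2 * (Real.toNNReal (σ ^ 2) : ℝ)))) with hg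
  have hgm : ∀ i j, Measurable (g i j) := fun i j => by fun_prop
  have hrow : ∀ i, rowGaussian σ (X' i) =
      (rowGaussian σ (X i)).withDensity fun w => ∏ j, g i j (w j) := fun i => by
    have e : ∀ j, gaussianReal (X' i j) (Real.toNNReal (σ ^ 2)) =
        (gaussianReal (X i j) (Real.toNNReal (σ ^ 2))).withDensity (g i j) := fun j =>
      gaussianReal_eq_withDensity _ _ hv
    have : ∀ j, SigmaFinite
        ((gaussianReal (X i j) (Real.toNNReal (σ ^ 2))).withDensity (g i j)) := fun j => by
      rw [← e]; infer_instance
    simp only [rowGaussian, e]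
    exact Measure.pi_withDensity _ (hgm i)
  have e : ∀ i, (if τ i then rowGaussian σ (X' i) else Measure.dirac (X' i)) =
      (if τ i then rowGaussian σ (X i) else Measure.dirac (X i)).withDensity
        fun w => ∏ j, g i j (w j) := fun i => by
    cases hi : τ i
    -- For an unselected row the two point masses coincide, and its factor of the ratio is `exp 0 =
    -- 1`.
    · have : (fun w : Fin D → ℝ => ∏ j, g i j (w j)) = 1 := by
        ext w; simp [hg, h i hi]
      rw [this, withDensity_one]
      simp [h i hi]
    · simpa using hrow i
  have : ∀ i, SigmaFinite ((if τ i then rowGaussian σ (X i) else Measure.dirac (X i)).withDensity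
        fun w => ∏ j, g i j (w j)) := fun i => by
    rw [← e]; infer_instance
  simp only [lowerLevel, e]
  exact Measure.pi_withDensity _ fun i => Finset.measurable_prod _ fun j _ =>
    (hgm i j).comp (measurable_pi_apply j)

theorem measurable_likelihoodRatio {N D : ℕ} (σ : ℝ) (X X' : DataMatrix N D) :
    Measurable (likelihoodRatio σ X X') := by
  unfold likelihoodRatio
  fun_prop

/-- The indicators that select all of the rows in which `X` and `X'` differ. -/
def selecting {N D : ℕ} (X X' : DataMatrix N D) : Set (Fin N → Bool) :=
  {τ | ∀ i ∈ perturbedRows X X', τ i = true}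

theorem eq_of_mem_selecting {N D : ℕ} {X X' : DataMatrix N D} {τ : Fin N → Bool}
    (hτ : τ ∈ selecting X X') (i : Fin N) (hi : τ i = false) : X i = X' i := by
  by_contra hne
  have := hτ i (by simpa [perturbedRows] using hne)
  simp [hi] at this

/-- The weights of `τ` do not depend on the centre, so the densities of the conditional laws combine
into one; the sections of `S` at other `τ` are empty. -/
theorem hierarchical_eq_setLIntegral {N D : ℕ} (p : unitInterval) {σ : ℝ} (hσ : 0 < σ)
    (X X' : DataMatrix N D) {S : Set (ExtMatrix N D)} (hS : MeasurableSet S)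
    (hsub : S ⊆ {Z | Z.2 ∈ selecting X X'}) :
    hierarchical p σ X' S = ∫⁻ Z in S, likelihoodRatio σ X X' Z.1 ∂hierarchical p σ X := by
  have hL := measurable_likelihoodRatio σ X X'
  have hL1 : Measurable fun Z : ExtMatrix N D => likelihoodRatio σ X X' Z.1 := hL.comp measurable_fst
  rw [← lintegral_indicator hS, hierarchical_apply p σ X' hS, hierarchical,
    lintegral_finsetSum_measure]
  refine Finset.sum_congr rfl fun τ _ => ?_
  rw [lintegral_smul_measure, lintegral_map (hL1.indicator hS) (by fun_prop), smul_eq_mul]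
  congr 1
  have hsec : MeasurableSet {W : DataMatrix N D | (W, τ) ∈ S} :=
    (measurable_id.prodMk measurable_const) hS
  by_cases hτ : τ ∈ selecting X X'
  · rw [lowerLevel_eq_withDensity hσ (eq_of_mem_selecting hτ), withDensity_apply _ hsec,
      ← lintegral_indicator hsec]
    rfl
  · have h0 : {W : DataMatrix N D | (W, τ) ∈ S} = ∅ := by
      ext W; simpa using fun hW => hτ (hsub hW)
    have h1 : ∀ W : DataMatrix N D, S.indicator
        (fun Z : ExtMatrix N D => likelihoodRatio σ X X' Z.1) (W, τ) = 0 := fun W =>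
      Set.indicator_of_notMem (fun hW => hτ (hsub hW)) _
    simp [h0, h1]

/-! ### Reduction to a one-dimensional Gaussian statistic -/

/-- Characteristic functions factor over the entries. As `w` vanishes on unselected rows, the point
masses contribute neither mean nor variance. -/
theorem lowerLevel_map_linear {N D : ℕ} (σ : ℝ) (Y : DataMatrix N D) (τ : Fin N → Bool)
    (w : DataMatrix N D) (hw : ∀ i, τ i = false → w i = 0) :
    (lowerLevel σ Y τ).map (fun W => ∑ i, ∑ j, w i j * W i j) =
      gaussianReal (∑ i, ∑ j, w i j * Y i j) (Real.toNNReal (σ ^ 2 * ∑ i, ∑ j, w i j ^ 2)) := by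
  have hm : Measurable fun W : DataMatrix N D => ∑ i, ∑ j, w i j * W i j := by fun_prop
  have : IsProbabilityMeasure ((lowerLevel σ Y τ).map fun W => ∑ i, ∑ j, w i j * W i j) :=
    Measure.isProbabilityMeasure_map hm.aemeasurable
  refine Measure.ext_of_charFun (funext fun t => ?_)
  rw [charFun_gaussianReal, charFun_apply_real, integral_map hm.aemeasurable (by fun_prop)]
  have hrow : ∀ i, ∫ x, ∏ j, Complex.exp (t * (w i j * x j : ℝ) * Complex.I)
      ∂(if τ i then rowGaussian σ (Y i) else Measure.dirac (Y i)) =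
      ∏ j, Complex.exp (t * (w i j * Y i j : ℝ) * Complex.I - σ ^ 2 * (w i j) ^ 2 * t ^ 2 / 2) := by
    intro i
    cases hi : τ i
    · simp [hw i hi]
    · simp only [if_true, rowGaussian]
      rw [integral_fintype_prod_eq_prod
        (fun j (x : ℝ) => Complex.exp (t * (w i j * x : ℝ) * Complex.I))]
      refine Finset.prod_congr rfl fun j _ => ?_
      have := charFun_gaussianReal (μ := Y i j) (v := Real.toNNReal (σ ^ 2)) (t * w i j)
      rw [charFun_apply_real] at this
      rw [Real.coe_toNNReal _ (sq_nonneg σ)] at this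
      have e : ∀ x : ℝ, (t : ℂ) * (w i j * x : ℝ) = (t * w i j : ℝ) * x := fun x => by
        push_cast; ring
      simp only [e, this]
      congr 1
      push_cast
      ring
  have hprod : ∀ W : DataMatrix N D,
      Complex.exp (t * (∑ i, ∑ j, w i j * W i j : ℝ) * Complex.I) =
        ∏ i, ∏ j, Complex.exp (t * (w i j * W i j : ℝ) * Complex.I) := fun W => by
    simp only [← Complex.exp_sum]
    congr 1
    push_cast
    simp only [Finset.mul_sum, Finset.sum_mul]
  simp only [hprod, lowerLevel]
  rw [integral_fintype_prod_eq_prod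
    (fun i (x : Fin D → ℝ) => ∏ j, Complex.exp (t * (w i j * x j : ℝ) * Complex.I))]
  simp only [hrow]
  simp only [← Complex.exp_sum]
  congr 1
  rw [Real.coe_toNNReal _ (by positivity)]
  push_cast
  simp only [Finset.sum_sub_distrib, Finset.mul_sum, Finset.sum_mul, Finset.sum_div]

theorem frobeniusNorm_sq {N D : ℕ} (M : DataMatrix N D) :
    frobeniusNorm M ^ 2 = ∑ i, ∑ j, M i j ^ 2 :=
  Real.sq_sqrt (by positivity)

theorem frobeniusNorm_nonneg {N D : ℕ} (M : DataMatrix N D) : 0 ≤ frobeniusNorm M :=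
  Real.sqrt_nonneg _

theorem frobeniusNorm_sub_pos {N D : ℕ} {X X' : DataMatrix N D} (h : X ≠ X') :
    0 < frobeniusNorm (X - X') := by
  refine (frobeniusNorm_nonneg _).lt_of_ne' fun h0 => h ?_
  have h1 := frobeniusNorm_sq (X - X')
  rw [h0, eq_comm, zero_pow two_ne_zero,
    Finset.sum_eq_zero_iff_of_nonneg fun i _ => by positivity] at h1
  ext i j
  have h2 := h1 i (Finset.mem_univ i)
  rw [Finset.sum_eq_zero_iff_of_nonneg fun j _ => by positivity] at h2
  have h3 := h2 j (Finset.mem_univ j)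
  exact sub_eq_zero.1 (pow_eq_zero_iff two_ne_zero |>.1 h3)

/-- The displacement from `X` in the direction of `X'`, in units of `σ`. -/
noncomputable def displacement {N D : ℕ} (σ : ℝ) (X X' W : DataMatrix N D) : ℝ :=
  ∑ i, ∑ j, (X' i j - X i j) / (σ * frobeniusNorm (X - X')) * W i j -
    ∑ i, ∑ j, (X' i j - X i j) / (σ * frobeniusNorm (X - X')) * X i j

theorem measurable_displacement {N D : ℕ} (σ : ℝ) (X X' : DataMatrix N D) :
    Measurable (displacement σ X X') := by
  unfold displacement; fun_prop

theorem displacement_self {N D : ℕ} (σ : ℝ) (X X' : DataMatrix N D) :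
    displacement σ X X' X = 0 := sub_self _

theorem displacement_target {N D : ℕ} {σ : ℝ} (hσ : 0 < σ) {X X' : DataMatrix N D} (h : X ≠ X') :
    displacement σ X X' X' = frobeniusNorm (X - X') / σ := by
  have hn := frobeniusNorm_sub_pos h
  have h2 := frobeniusNorm_sq (X - X')
  have : displacement σ X X' X' =
      (∑ i, ∑ j, (X - X') i j ^ 2) / (σ * frobeniusNorm (X - X')) := by
    simp only [displacement, ← Finset.sum_sub_distrib, Finset.sum_div, Pi.sub_apply]
    refine Finset.sum_congr rfl fun i _ => Finset.sum_congr rfl fun j _ => ?_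
    ring
  rw [this, ← h2]
  field_simp

theorem lowerLevel_map_displacement {N D : ℕ} {σ : ℝ} (hσ : 0 < σ) {X X' : DataMatrix N D}
    (h : X ≠ X') (Y : DataMatrix N D) {τ : Fin N → Bool} (hτ : τ ∈ selecting X X') :
    (lowerLevel σ Y τ).map (displacement σ X X') = gaussianReal (displacement σ X X' Y) 1 := by
  have hn := frobeniusNorm_sub_pos h
  have hlin := lowerLevel_map_linear σ Y τ
    (fun i j => (X' i j - X i j) / (σ * frobeniusNorm (X - X')))
    (fun i hi => by ext j; simp [eq_of_mem_selecting hτ i hi])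
  have hvar : σ ^ 2 * ∑ i, ∑ j, ((X' i j - X i j) / (σ * frobeniusNorm (X - X'))) ^ 2 = 1 := by
    have : ∑ i, ∑ j, ((X' i j - X i j) / (σ * frobeniusNorm (X - X'))) ^ 2 =
        (∑ i, ∑ j, (X - X') i j ^ 2) / (σ * frobeniusNorm (X - X')) ^ 2 := by
      simp only [Finset.sum_div, Pi.sub_apply]
      refine Finset.sum_congr rfl fun i _ => Finset.sum_congr rfl fun j _ => ?_
      rw [div_pow]; ring
    rw [this, ← frobeniusNorm_sq]
    field_simp
  rw [hvar, Real.toNNReal_one] at hlin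
  have := gaussianReal_map_sub_const
    (μ := ∑ i, ∑ j, (X' i j - X i j) / (σ * frobeniusNorm (X - X')) * Y i j) (v := 1)
    (∑ i, ∑ j, (X' i j - X i j) / (σ * frobeniusNorm (X - X')) * X i j)
  rw [← hlin, Measure.map_map (by fun_prop) (by fun_prop)] at this
  exact this

/-- The exponents add up to a linear function of `W` with positive slope along `X' - X`, so sublevel
sets of the ratio are half-spaces. -/
theorem likelihoodRatio_eq {N D : ℕ} {σ : ℝ} (hσ : 0 < σ) {X X' : DataMatrix N D} (h : X ≠ X')
    (W : DataMatrix N D) :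
    likelihoodRatio σ X X' W = ENNReal.ofReal (Real.exp
      (frobeniusNorm (X - X') / σ * displacement σ X X' W -
        frobeniusNorm (X - X') ^ 2 / (2 * σ ^ 2))) := by
  have hn := frobeniusNorm_sub_pos h
  simp only [likelihoodRatio]
  rw [Real.coe_toNNReal _ (sq_nonneg σ), frobeniusNorm_sq]
  simp_rw [← ENNReal.ofReal_prod_of_nonneg fun i _ => (Real.exp_pos _).le, ← Real.exp_sum]
  rw [← ENNReal.ofReal_prod_of_nonneg fun i _ => (Real.exp_pos _).le, ← Real.exp_sum]
  congr 2
  simp only [displacement, ← Finset.sum_sub_distrib, Finset.mul_sum, Finset.sum_div, Pi.sub_apply]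
  refine Finset.sum_congr rfl fun i _ => Finset.sum_congr rfl fun j _ => ?_
  field_simp
  ring

/-! ### Singular and absolutely continuous parts -/

/-- The event that all rows in which `X` and `X'` differ are selected. -/
def selectedEvent {N D : ℕ} (X X' : DataMatrix N D) : Set (ExtMatrix N D) :=
  {Z | Z.2 ∈ selecting X X'}

theorem measurableSet_selectedEvent {N D : ℕ} (X X' : DataMatrix N D) :
    MeasurableSet (selectedEvent X X') :=
  measurable_snd (Set.toFinite (selecting X X')).measurableSet

/-- The event that every row that is not selected agrees with `X`. -/
def keptEvent {N D : ℕ} (X : DataMatrix N D) : Set (ExtMatrix N D) :=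
  {Z | ∀ i, Z.2 i = false → Z.1 i = X i}

theorem measurableSet_keptEvent {N D : ℕ} (X : DataMatrix N D) :
    MeasurableSet (keptEvent X) := by
  have : keptEvent X = ⋂ i, ({Z : ExtMatrix N D | Z.2 i = false}ᶜ ∪ {Z | Z.1 i = X i}) := by
    ext Z; simp [keptEvent, imp_iff_not_or]
  rw [this]
  refine MeasurableSet.iInter fun i => (MeasurableSet.compl ?_).union ?_
  · exact measurableSet_preimage (f := fun Z : ExtMatrix N D => Z.2 i) (by fun_prop)
      (measurableSet_singleton false)
  · exact measurableSet_preimage (f := fun Z : ExtMatrix N D => Z.1 i) (by fun_prop)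
      (measurableSet_singleton (X i))

theorem hierarchical_compl_keptEvent {N D : ℕ} (p : unitInterval) (σ : ℝ) (X : DataMatrix N D) :
    hierarchical p σ X (keptEvent X)ᶜ = 0 := by
  rw [hierarchical_apply_of_section p σ X (measurableSet_keptEvent X).compl Set.univ 0, mul_zero]
  · exact fun τ _ => lowerLevel_ae_eq σ X τ
  · simp

theorem hierarchical_keptEvent_diff {N D : ℕ} (p : unitInterval) (σ : ℝ) (X X' : DataMatrix N D) :
    hierarchical p σ X' (keptEvent X \ selectedEvent X X') = 0 := by
  rw [hierarchical_apply_of_section p σ X'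
    ((measurableSet_keptEvent X).diff (measurableSet_selectedEvent X X')) Set.univ 0, mul_zero]
  · intro τ _
    refine measure_mono_null ?_ (lowerLevel_ae_eq σ X' τ)
    rintro W ⟨hk, hs⟩ hW
    -- An unselected differing row would have to equal both `X i` and `X' i`.
    refine hs fun i hi => ?_
    by_contra hτ
    have hτ : τ i = false := by simpa using hτ
    have hne : X i ≠ X' i := by simpa [perturbedRows] using hi
    exact hne ((hk i hτ).symm.trans (hW i hτ))
  · simp

theorem hierarchical_selectedEvent {N D : ℕ} (p : unitInterval) (σ : ℝ) (X X' Y : DataMatrix N D) :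
    (hierarchical p σ Y).real (selectedEvent X X') = (p : ℝ) ^ (perturbedRows X X').card := by
  rw [Measure.real, hierarchical_apply_of_section p σ Y (measurableSet_selectedEvent X X')
    (selecting X X') 1]
  · rw [selecting, upperLevel_forall_mem, mul_one, ENNReal.toReal_ofReal (pow_nonneg p.2.1 _)]
  · intro τ hτ
    simp [selectedEvent, hτ]
  · intro τ hτ
    simp [selectedEvent, hτ]

/-- The part of `selectedEvent` with small likelihood ratio. -/
def sublevelEvent {N D : ℕ} (σ : ℝ) (X X' : DataMatrix N D) (z : EReal) : Set (ExtMatrix N D) :=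
  {Z | Z.2 ∈ selecting X X' ∧ (displacement σ X X' Z.1 : EReal) ≤ z}

theorem measurableSet_sublevelEvent {N D : ℕ} (σ : ℝ) (X X' : DataMatrix N D) (z : EReal) :
    MeasurableSet (sublevelEvent σ X X' z) :=
  (measurableSet_selectedEvent X X').inter (measurableSet_le
    (measurable_coe_real_ereal.comp ((measurable_displacement σ X X').comp measurable_fst))
    measurable_const)

theorem hierarchical_sublevelEvent {N D : ℕ} (p : unitInterval) {σ : ℝ} (hσ : 0 < σ)
    {X X' : DataMatrix N D} (h : X ≠ X') (Y : DataMatrix N D) (z : EReal) :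
    (hierarchical p σ Y).real (sublevelEvent σ X X' z) =
      normalCDF (z - displacement σ X X' Y) * (p : ℝ) ^ (perturbedRows X X').card := by
  have hT : MeasurableSet {t : ℝ | (t : EReal) ≤ z} :=
    measurableSet_le measurable_coe_real_ereal measurable_const
  rw [Measure.real, hierarchical_apply_of_section p σ Y (measurableSet_sublevelEvent σ X X' z)
    (selecting X X') (gaussianReal (displacement σ X X' Y) 1 {t : ℝ | (t : EReal) ≤ z})]
  · rw [selecting, upperLevel_forall_mem, ENNReal.toReal_mul,
      ENNReal.toReal_ofReal (pow_nonneg p.2.1 _), mul_comm, ← gaussianReal_real_le, Measure.real]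
  · intro τ hτ
    rw [← lowerLevel_map_displacement hσ h Y hτ,
      Measure.map_apply (measurable_displacement σ X X') hT]
    congr 1 with W
    simp [sublevelEvent, hτ]
  · intro τ hτ
    simp [sublevelEvent, hτ]

theorem hierarchical_sublevelEvent_le {N D : ℕ} (p : unitInterval) {σ : ℝ} (hσ : 0 < σ)
    {X X' : DataMatrix N D} (h : X ≠ X') (z : EReal) {B : Set (ExtMatrix N D)}
    (hB : MeasurableSet B) (hBR : B ⊆ selectedEvent X X')
    (hle : hierarchical p σ X (sublevelEvent σ X X' z) ≤ hierarchical p σ X B) :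
    hierarchical p σ X' (sublevelEvent σ X X' z) ≤ hierarchical p σ X' B := by
  have hn := frobeniusNorm_sub_pos h
  have key : ∀ k : ENNReal,
      (∀ W, (displacement σ X X' W : EReal) ≤ z → likelihoodRatio σ X X' W ≤ k) →
      (∀ W, ¬ (displacement σ X X' W : EReal) ≤ z → k ≤ likelihoodRatio σ X X' W) →
      hierarchical p σ X' (sublevelEvent σ X X' z) ≤ hierarchical p σ X' B := fun k h1 h2 =>
    neymanPearson_of_density (R := selectedEvent X X')
      (L := fun Z => likelihoodRatio σ X X' Z.1) (k := k)
      (fun S hS hSm => hierarchical_eq_setLIntegral p hσ X X' hSm hS)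
      (measurableSet_sublevelEvent σ X X' z) (fun Z hZ => hZ.1) hB hBR
      (fun Z hZ => h1 _ hZ.2) (fun Z hZ hZ' => h2 _ fun hz => hZ' ⟨hZ, hz⟩) hle
  induction z with
  -- The Neyman–Pearson threshold is the ratio at displacement `z`, replaced by `0` and `⊤` at the
  -- infinite ends.
  | bot => exact key 0 (by simp) (by simp)
  | top => exact key ⊤ (by simp) (by simp)
  | coe t =>
    refine key (ENNReal.ofReal (Real.exp (frobeniusNorm (X - X') / σ * t -
        frobeniusNorm (X - X') ^ 2 / (2 * σ ^ 2)))) (fun W hW => ?_) (fun W hW => ?_)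
    · rw [likelihoodRatio_eq hσ h]
      have := EReal.coe_le_coe_iff.1 hW
      gcongr
    · rw [likelihoodRatio_eq hσ h]
      have := (not_le.1 (mt EReal.coe_le_coe_iff.2 hW)).le
      gcongr

/-! ### The minimum for a fixed perturbed matrix -/

/-- With at least two labels, every measurable event is the event that some classifier outputs
`y`. -/
theorem exists_classifier {α : Type*} [MeasurableSpace α] {K : ℕ} (hK : 2 ≤ K) (y : Fin K)
    {A : Set α} (hA : MeasurableSet A) :
    ∃ h : α → Fin K, Measurable h ∧ {a | h a = y} = A := by
  classical
  have : Nontrivial (Fin K) := Fin.nontrivial_iff_two_le.2 hK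
  obtain ⟨y', hy'⟩ := exists_ne y
  refine ⟨fun a => if a ∈ A then y else y', measurable_const.ite hA measurable_const, ?_⟩
  ext a
  by_cases ha : a ∈ A <;> simp [ha, hy']

theorem labelProb_nonneg {N D K : ℕ} (p : unitInterval) (σ : ℝ) (h : ExtMatrix N D → Fin K)
    (y : Fin K) (X : DataMatrix N D) : 0 ≤ labelProb p σ h y X := measureReal_nonneg

theorem labelProb_le_one {N D K : ℕ} (p : unitInterval) (σ : ℝ) (h : ExtMatrix N D → Fin K)
    (y : Fin K) (X : DataMatrix N D) : labelProb p σ h y X ≤ 1 := measureReal_le_one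

/-- The certified lower bound for overall probability `P`, when all perturbed rows are selected
with probability `s` and the perturbation has size `δ` relative to the noise. -/
noncomputable def certifiedProb (P s δ : ℝ) : ℝ :=
  normalCDF (normalCDFInv ((P - (1 - s)) / s) - (δ : EReal)) * s

theorem certifiedProb_one_zero {P : ℝ} (h0 : 0 ≤ P) (h1 : P ≤ 1) : certifiedProb P 1 0 = P := by
  simp [certifiedProb, normalCDF_normalCDFInv h0 h1]

/-- The argument of the inverse is `1 - (1 - P) / s`, which increases with `s` since `P ≤ 1`. -/
theorem certifiedProb_mono {P s s' δ δ' : ℝ} (hP : P ≤ 1) (hs : 0 < s) (hss : s ≤ s')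
    (hδ : δ' ≤ δ) : certifiedProb P s δ ≤ certifiedProb P s' δ' := by
  have hs' := hs.trans_le hss
  have hu : (P - (1 - s)) / s ≤ (P - (1 - s')) / s' := by
    rw [div_le_div_iff₀ hs hs']
    nlinarith [mul_nonneg (sub_nonneg.2 hP) (sub_nonneg.2 hss)]
  refine mul_le_mul (normalCDF_mono ?_) hss hs.le (normalCDF_nonneg _)
  exact EReal.sub_le_sub (normalCDFInv_mono hu) (EReal.coe_le_coe_iff.2 hδ)

theorem isLeast_feasibleValues_self {N D K : ℕ} (p : unitInterval) (σ : ℝ)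
    {f : ExtMatrix N D → Fin K} (hf : Measurable f) (y : Fin K) (X : DataMatrix N D) :
    IsLeast (feasibleValues p σ f y X X) (labelProb p σ f y X) :=
  ⟨⟨f, hf, rfl, rfl⟩, by rintro v ⟨h, -, h1, rfl⟩; exact h1.ge⟩

theorem isLeast_feasibleValues {N D K : ℕ} (hK : 2 ≤ K) (p : unitInterval) {σ : ℝ} (hσ : 0 < σ)
    (f : ExtMatrix N D → Fin K) (y : Fin K) {X X' : DataMatrix N D} (h : X ≠ X')
    (hp : 0 < (p : ℝ))
    (hP : 1 - (p : ℝ) ^ (perturbedRows X X').card ≤ labelProb p σ f y X) :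
    IsLeast (feasibleValues p σ f y X X') (certifiedProb (labelProb p σ f y X)
      ((p : ℝ) ^ (perturbedRows X X').card) (frobeniusNorm (X - X') / σ)) := by
  set P := labelProb p σ f y X
  set s := (p : ℝ) ^ (perturbedRows X X').card
  have hs : 0 < s := pow_pos hp _
  set z := normalCDFInv ((P - (1 - s)) / s)
  have hz : normalCDF z * s = P - (1 - s) := by
    rw [normalCDF_normalCDFInv (div_nonneg (by linarith) hs.le)
      ((div_le_one hs).2 (by linarith [labelProb_le_one p σ f y X])), div_mul_cancel₀ _ hs.ne']
  have hX : (hierarchical p σ X).real (sublevelEvent σ X X' z) = P - (1 - s) := by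
    rw [hierarchical_sublevelEvent p hσ h, displacement_self, EReal.coe_zero, sub_zero, hz]
  have hX' : (hierarchical p σ X').real (sublevelEvent σ X X' z) =
      certifiedProb P s (frobeniusNorm (X - X') / σ) := by
    rw [hierarchical_sublevelEvent p hσ h, displacement_target hσ h, certifiedProb]
  have hU : (hierarchical p σ X).real (selectedEvent X X')ᶜ = 1 - s := by
    rw [probReal_compl_eq_one_sub (measurableSet_selectedEvent X X'), hierarchical_selectedEvent]
  have hmK := (measurableSet_keptEvent X).diff (measurableSet_selectedEvent X X')
  have hmS := measurableSet_sublevelEvent σ X X' z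
  have hdisj : Disjoint (keptEvent X \ selectedEvent X X') (sublevelEvent σ X X' z) :=
    Set.disjoint_left.2 fun Z hZ hZ' => hZ.2 hZ'.1
  constructor
  -- The minimizer outputs `y` on the free singular part, of mass `1 - s` at `X`, and on the
  -- half-space of mass `P - (1 - s)`.
  · obtain ⟨g, hg, hgA⟩ := exists_classifier hK y (hmK.union hmS)
    refine ⟨g, hg, ?_, ?_⟩
    · have : (hierarchical p σ X).real (keptEvent X \ selectedEvent X X') = 1 - s := by
        rw [← hU]
        refine measureReal_congr ?_
        have : ∀ᵐ Z ∂hierarchical p σ X, Z ∈ keptEvent X := hierarchical_compl_keptEvent p σ X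
        filter_upwards [this] with Z hZ
        exact propext ⟨fun hh => hh.2, fun hh => ⟨hZ, hh⟩⟩
      rw [labelProb, hgA, measureReal_union hdisj hmS, this, hX]
      ring
    · rw [labelProb, hgA, measureReal_union hdisj hmS, hX', Measure.real,
        hierarchical_keptEvent_diff, ENNReal.toReal_zero, zero_add]
  · rintro v ⟨g, hg, hgX, rfl⟩
    have hB : MeasurableSet {Z | g Z = y} := hg (measurableSet_singleton y)
    -- At most `1 - s` of the mass of a competitor lies off the selected event, so at least `P - (1
    -- - s)` lies on it.
    have hle : (hierarchical p σ X).real (sublevelEvent σ X X' z) ≤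
        (hierarchical p σ X).real ({Z | g Z = y} ∩ selectedEvent X X') := by
      have h1 := measureReal_inter_add_sdiff (μ := hierarchical p σ X) (s := {Z | g Z = y})
        (measurableSet_selectedEvent X X')
      have h2 : (hierarchical p σ X).real ({Z | g Z = y} \ selectedEvent X X') ≤ 1 - s := by
        rw [← hU]; exact measureReal_mono fun Z hZ => hZ.2
      rw [labelProb] at hgX
      rw [hX]
      linarith
    have hle' := hierarchical_sublevelEvent_le p hσ h z
      (hB.inter (measurableSet_selectedEvent X X')) Set.inter_subset_right
      ((ENNReal.toReal_le_toReal (measure_ne_top _ _) (measure_ne_top _ _)).1 hle)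
    rw [← hX', labelProb]
    exact ENNReal.toReal_mono (measure_ne_top _ _)
      (hle'.trans (measure_mono Set.inter_subset_left))

/-- Without noise the laws are mutually singular: restricting the region of `f` to the singular part
changes nothing at `X` and leaves a null set at `X'`. -/
theorem isLeast_feasibleValues_of_eq_zero {N D K : ℕ} (hK : 2 ≤ K) {p : unitInterval} (σ : ℝ)
    {f : ExtMatrix N D → Fin K} (hf : Measurable f) (y : Fin K) {X X' : DataMatrix N D}
    (h : X ≠ X') (hp : (p : ℝ) = 0) :
    IsLeast (feasibleValues p σ f y X X') 0 := by
  refine ⟨?_, by rintro v ⟨g, -, -, rfl⟩; exact labelProb_nonneg p σ g y X'⟩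
  have hB : MeasurableSet {Z | f Z = y} := hf (measurableSet_singleton y)
  have hmK := (measurableSet_keptEvent X).diff (measurableSet_selectedEvent X X')
  obtain ⟨g, hg, hgA⟩ := exists_classifier hK y (hB.inter hmK)
  refine ⟨g, hg, ?_, ?_⟩
  · rw [labelProb, hgA, labelProb]
    have hcard : (perturbedRows X X').card ≠ 0 := by
      obtain ⟨i, hi⟩ := Function.ne_iff.1 h
      exact Finset.card_ne_zero_of_mem (a := i) (by simpa [perturbedRows] using hi)
    have hsel : hierarchical p σ X (selectedEvent X X') = 0 := by
      have := hierarchical_selectedEvent p σ X X' X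
      rwa [hp, zero_pow hcard, measureReal_eq_zero_iff] at this
    refine measureReal_congr ?_
    have h1 : ∀ᵐ Z ∂hierarchical p σ X, Z ∈ keptEvent X := hierarchical_compl_keptEvent p σ X
    have h2 : ∀ᵐ Z ∂hierarchical p σ X, Z ∉ selectedEvent X X' := measure_eq_zero_iff_ae_notMem.1 hsel
    filter_upwards [h1, h2] with Z hZ hZ'
    exact propext ⟨fun hh => hh.1, fun hh => ⟨hh, hZ, hZ'⟩⟩
  · rw [labelProb, hgA, Measure.real, measure_mono_null Set.inter_subset_right
      (hierarchical_keptEvent_diff p σ X X'), ENNReal.toReal_zero]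

/-! ### The minimum over the threat model -/

/-- The extreme point of the threat model: exactly `r` rows are perturbed, with total size `ε`. -/
theorem exists_extreme_perturbation {N D : ℕ} (hD : 1 ≤ D) {r : ℕ} (hr : 1 ≤ r) (hrN : r ≤ N)
    {ε : ℝ} (hε : 0 < ε) (X : DataMatrix N D) :
    ∃ X' : DataMatrix N D, (perturbedRows X X').card = r ∧ frobeniusNorm (X - X') = ε := by
  classical
  obtain ⟨C, -, hC⟩ := Finset.exists_subset_card_eq
    (s := (Finset.univ : Finset (Fin N))) (n := r) (by simpa using hrN)
  have hr0 : (0 : ℝ) < r := by exact_mod_cast hr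
  have hs : 0 < ε / Real.sqrt r := div_pos hε (Real.sqrt_pos.2 hr0)
  let j₀ : Fin D := ⟨0, hD⟩
  -- A shift of one entry by `ε / √r` in each of `r` rows has squares summing to `ε ^ 2`.
  refine ⟨fun i j => if i ∈ C ∧ j = j₀ then X i j - ε / Real.sqrt r else X i j, ?_, ?_⟩
  · refine Eq.trans (congrArg Finset.card ?_) hC
    ext i
    simp only [perturbedRows, Finset.mem_filter, Finset.mem_univ, true_and]
    constructor
    · intro hne
      by_contra hi
      exact hne (by ext j; simp [hi])
    · intro hi heq
      have := congrFun heq j₀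
      simp only [hi, true_and, if_true] at this
      linarith
  · have h1 : ∀ i j, (X - fun i j => if i ∈ C ∧ j = j₀ then X i j - ε / Real.sqrt r else X i j) i j ^ 2
        = if j = j₀ then (if i ∈ C then ε ^ 2 / r else 0) else 0 := fun i j => by
      by_cases hi : i ∈ C <;> by_cases hj : j = j₀ <;>
        simp [hi, hj, div_pow, Real.sq_sqrt hr0.le]
    rw [frobeniusNorm]
    simp_rw [h1]
    simp only [Finset.sum_ite_eq', Finset.mem_univ, if_true, Finset.sum_ite_mem, Finset.univ_inter,
      Finset.sum_const, hC, nsmul_eq_mul]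
    rw [mul_div_cancel₀ _ hr0.ne', Real.sqrt_sq hε.le]

theorem proposition3 {N D K : ℕ} (hD : 1 ≤ D) (hK : 2 ≤ K)
    (p : unitInterval) (σ : ℝ) (hσ : 0 < σ)
    (r : ℕ) (hr : 1 ≤ r) (hrN : r ≤ N) (ε : ℝ) (hε : 0 < ε)
    (X : DataMatrix N D) (f : ExtMatrix N D → Fin K) (hf : Measurable f) (y : Fin K)
    (Δ : ℝ) (hΔ : Δ = 1 - (p : ℝ) ^ r)
    (hp : 0 < (p : ℝ) → Δ ≤ labelProb p σ f y X) :
    (∀ X' ∈ threatBall r ε X,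
      IsLeast (feasibleValues p σ f y X X') (worstCaseProb p σ f y X X')) ∧
    IsLeast (worstCaseProb p σ f y X '' threatBall r ε X)
      (normalCDF (normalCDFInv ((labelProb p σ f y X - Δ) / (1 - Δ)) -
        ((ε / σ : ℝ) : EReal)) * (1 - Δ)) := by
  subst hΔ
  obtain ⟨X₁, hcard, hnorm⟩ := exists_extreme_perturbation hD hr hrN hε X
  have hne : X ≠ X₁ := by
    rintro rfl
    simp [perturbedRows] at hcard
    omega
  have hX₁ : X₁ ∈ threatBall r ε X := ⟨hcard.le, hnorm.le⟩
  have hworst : ∀ {X' v}, IsLeast (feasibleValues p σ f y X X') v →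
      worstCaseProb p σ f y X X' = v := fun h => h.csInf_eq
  have hself := isLeast_feasibleValues_self p σ hf y X
  rcases p.2.1.eq_or_lt with hp0 | hp0
  · have hleast : ∀ X', ∃ v, 0 ≤ v ∧ IsLeast (feasibleValues p σ f y X X') v := fun X' => by
      by_cases h : X = X'
      · exact ⟨_, labelProb_nonneg p σ f y X, h ▸ hself⟩
      · exact ⟨0, le_rfl, isLeast_feasibleValues_of_eq_zero hK σ hf y h hp0.symm⟩
    -- Here `1 - Δ = 0`, so the factor `1 - Δ` makes the bound `0`, whatever value the division by
    -- zero has.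
    rw [← hp0, zero_pow (by omega), sub_zero, sub_self, mul_zero]
    refine ⟨fun X' _ => ?_, ⟨X₁, hX₁, ?_⟩, ?_⟩
    · obtain ⟨v, -, hv⟩ := hleast X'
      rwa [hworst hv]
    · exact hworst (isLeast_feasibleValues_of_eq_zero hK σ hf y hne hp0.symm)
    · rintro _ ⟨X', -, rfl⟩
      obtain ⟨v, hv0, hv⟩ := hleast X'
      rwa [hworst hv]
  · have hcert : ∀ X' ∈ threatBall r ε X, IsLeast (feasibleValues p σ f y X X')
        (certifiedProb (labelProb p σ f y X)
          ((p : ℝ) ^ (perturbedRows X X').card) (frobeniusNorm (X - X') / σ)) := fun X' hX' => by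
      -- The direction of displacement degenerates at `X' = X`; there `s = 1` and the shift is `0`,
      -- and the formula returns `P`.
      by_cases h : X = X'
      · subst h
        have h1 : (perturbedRows X X).card = 0 := by simp [perturbedRows]
        have h2 : frobeniusNorm (X - X) = 0 := by simp [frobeniusNorm]
        rw [h1, h2, pow_zero, zero_div, certifiedProb_one_zero (labelProb_nonneg p σ f y X)
          (labelProb_le_one p σ f y X)]
        exact hself
      · refine isLeast_feasibleValues hK p hσ f y h hp0 (le_trans ?_ (hp hp0))
        exact sub_le_sub_left (pow_le_pow_of_le_one p.2.1 p.2.2 hX'.1) 1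
    have hgoal : normalCDF (normalCDFInv ((labelProb p σ f y X - (1 - (p : ℝ) ^ r)) /
        (1 - (1 - (p : ℝ) ^ r))) - ((ε / σ : ℝ) : EReal)) * (1 - (1 - (p : ℝ) ^ r)) =
        certifiedProb (labelProb p σ f y X) ((p : ℝ) ^ r) (ε / σ) := by
      rw [certifiedProb, sub_sub_cancel]
    rw [hgoal]
    refine ⟨fun X' hX' => ?_, ⟨X₁, hX₁, ?_⟩, ?_⟩
    · rw [hworst (hcert X' hX')]
      exact hcert X' hX'
    · rw [hworst (hcert X₁ hX₁), hcard, hnorm]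
    · rintro _ ⟨X', hX', rfl⟩
      rw [hworst (hcert X' hX')]
      exact certifiedProb_mono (labelProb_le_one p σ f y X) (pow_pos hp0 r)
        (pow_le_pow_of_le_one p.2.1 p.2.2 hX'.1)
        (div_le_div_of_nonneg_right hX'.2 hσ.le)
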